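/- A polynomial $p\in\mathbb R[x_1,\dots,x_n]$ is a real zero polynomial if $p(0)=1$ and, for every $a\in\mathbb R^n$ and $\mu\in\mathbb C$, $p(\mu a)=0$ implies $\mu\in\mathbb R$. It has a determinantal representation if $p=\det(I+x_1M_1+\cdots+x_nM_n)$ for some $k\ge 0$ and some complex hermitian $k\times k$ matrices $M_1,\dots,M_n$. Let $\mathcal R_{n,d}$ be the set of real zero polynomials of total degree at most $d$ in $n$ variables, viewed inside the finite-dimensional vector space $\mathbb R[x_1,\dots,x_n]_d$ of polynomials of degree at most $d$, and let $\mathcal D_{n,d}\subseteq\mathcal R_{n,d}$ be the subset of those that have a determinantal representation. The dimension of such a (semialgebraic) set is the Krull dimension of its ring of polynomial functions. Suppose that either $d\ge 4$ is fixed and $n$ is large enough (depending on $d$), or $n\ge 3$ is fixed and $d$ is large enough (depending on $n$). Then $$\dim\mathcal D_{n,d}\;\le\; n^3d^2\;<\;\binom{n+d}{d}-1\;=\;\dim\mathcal R_{n,d}.$$ In particular $\mathcal D_{n,d}$ has strictly smaller dimension than $\mathcal R_{n,d}$, i.e. almost no polynomial in $\mathcal R_{n,d}$ has a determinantal representation,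 and $\mathcal R_{n,d}\setminus\mathcal D_{n,d}\neq\emptyset$, so the generalized Lax conjecture fails. -/

import Mathlib

/-- The ring of polynomial functions on a subset `S` of a finite-dimensional real vector space
`V`: the real algebra of functions on `S` generated by the restrictions of the linear forms on
`V`. In linear coordinates it is `ℝ[X₁, …, X_N] / I(S)`, where `I(S)` is the ideal of the
polynomials vanishing on `S`. -/
def polyFunctionRing {V : Type*} [AddCommGroup V] [Module ℝ V] (S : Set V) :
    Subalgebra ℝ (S → ℝ) :=
  Algebra.adjoin ℝ (Set.range fun (φ : Module.Dual ℝ V) (s : S) => φ (s : V))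

/-- The dimension, in the sense of real algebraic geometry, of a (semialgebraic) subset `S` of a
finite-dimensional real vector space: the Krull dimension of the ring of polynomial functions
on `S`. -/
noncomputable def semialgebraicDim {V : Type*} [AddCommGroup V] [Module ℝ V] (S : Set V) :
    WithBot ℕ∞ :=
  ringKrullDim (polyFunctionRing S)

/-- Real zero polynomials: `p(0) = 1`, and for every `a ∈ ℝⁿ` all complex zeros `μ` of
`t ↦ p(t a)` are real. -/
def IsRealZero {n : ℕ} (p : MvPolynomial (Fin n) ℝ) : Prop :=
  MvPolynomial.eval 0 p = 1 ∧
    ∀ (a : Fin n → ℝ) (μ : ℂ),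
      MvPolynomial.aeval (fun i => μ * (a i : ℂ)) p = 0 → μ.im = 0

/-- The monic linear matrix polynomial `I + x₁ M₁ + ⋯ + xₙ Mₙ` of size `k`. -/
noncomputable def monicPencil {n k : ℕ} (M : Fin n → Matrix (Fin k) (Fin k) ℂ) :
    Matrix (Fin k) (Fin k) (MvPolynomial (Fin n) ℂ) :=
  1 + ∑ i, (MvPolynomial.X i : MvPolynomial (Fin n) ℂ) • (M i).map MvPolynomial.C

/-- `p` is the determinant of a monic hermitian linear matrix polynomial, of some (arbitrary)
size. -/
def HasDetRepresentation {n : ℕ} (p : MvPolynomial (Fin n) ℝ) : Prop :=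
  ∃ (k : ℕ) (M : Fin n → Matrix (Fin k) (Fin k) ℂ),
    (∀ i, (M i).IsHermitian) ∧
      MvPolynomial.map (algebraMap ℝ ℂ) p = (monicPencil M).det

/-- `ℝ[x₁, …, xₙ]_d`: the vector space of polynomials of total degree at most `d`. -/
noncomputable abbrev PolyDeg (n d : ℕ) : Submodule ℝ (MvPolynomial (Fin n) ℝ) :=
  MvPolynomial.restrictTotalDegree (Fin n) ℝ d

/-- The set of real zero polynomials of degree at most `d` in `n` variables. -/
def realZeroSet (n d : ℕ) : Set (PolyDeg n d) :=
  {p | IsRealZero (p : MvPolynomial (Fin n) ℝ)}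

/-- The set of real zero polynomials of degree at most `d` in `n` variables that have a
determinantal representation. -/
def detSet (n d : ℕ) : Set (PolyDeg n d) :=
  {p | p ∈ realZeroSet n d ∧ HasDetRepresentation (p : MvPolynomial (Fin n) ℝ)}

/-- Almost no real zero polynomial of degree at most `d` in `n` variables has a determinantal
representation: those that have one form a set of strictly smaller dimension. -/
def AlmostNoDetRepresentation (n d : ℕ) : Prop :=
  semialgebraicDim (detSet n d) < semialgebraicDim (realZeroSet n d)

/-! This is a parameter count. If `p` has degree at most `d` and `p = det(I + ∑ xᵢMᵢ)`, restriction
to the `i`-th axis shows that the hermitian `Mᵢ` has rank at most `d`. So the sum of the ranges has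
dimension at most `n * d`, and compressing to it keeps the determinant
(`HasDetRepresentation.exists_size_eq`). The coefficients of `p` are then polynomials in `n * (n *
d) ^ 2` real parameters, which bounds the dimension by Noether normalization
(`semialgebraicDim_le_card`).

The real zero polynomials, in contrast, contain a full box of coefficients, apart from the constant
term fixed at 1 (`exists_isRealZero_of_near`). Its centre has, on every line through 0, simple real
roots after reversal, and these survive small perturbations by sign changes. A box is Zariski dense,
so the dimension is the number of nonconstant monomials. This grows like `n ^ d` for fixed `d` and
like `d ^ n` for fixed `n`, which beats `n ^ 3 * d ^ 2` when `d ≥ 4` or `n ≥ 3` respectively. -/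

/-! ### Krull dimension of rings of polynomial functions -/

theorem ringKrullDim_le_of_isIntegral (R S : Type*) [CommRing R] [CommRing S] [Algebra R S]
    [Algebra.IsIntegral R S] : ringKrullDim S ≤ ringKrullDim R :=
  Order.krullDim_le_of_strictMono (PrimeSpectrum.comap (algebraMap R S)) fun I J hIJ =>
    Ideal.IsIntegral.comap_lt_comap (I := I.asIdeal) (J := J.asIdeal) hIJ

theorem MvPolynomial.ringKrullDim_of_field (σ K : Type*) [Finite σ] [Field K] :
    ringKrullDim (MvPolynomial σ K) = (Nat.card σ : WithBot ℕ∞) := by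
  rw [MvPolynomial.ringKrullDim_of_isNoetherianRing, ringKrullDim_eq_zero_of_field, zero_add]

theorem finiteType_polyFunctionRing {V : Type*} [AddCommGroup V] [Module ℝ V]
    [Module.Finite ℝ V] (S : Set V) : Algebra.FiniteType ℝ (polyFunctionRing S) := by
  let L : Module.Dual ℝ V →ₗ[ℝ] (S → ℝ) :=
    { toFun := fun φ s => φ (s : V)
      map_add' := fun _ _ => rfl
      map_smul' := fun _ _ => rfl }
  obtain ⟨t, ht⟩ := (Module.Finite.fg_top (R := ℝ) (M := Module.Dual ℝ V))
  have h : polyFunctionRing S = Algebra.adjoin ℝ (L '' t) := by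
    rw [← Algebra.adjoin_span (R := ℝ) (s := L '' t), Submodule.span_image, ht, Submodule.map_top]
    rfl
  rw [← Subalgebra.fg_iff_finiteType]
  exact Subalgebra.fg_def.2 ⟨L '' t, t.finite_toSet.image _, h.symm⟩

/-- The evaluation of polynomials along a family of points. -/
noncomputable def evalFamily {ι σ : Type*} (x : ι → σ → ℝ) :
    MvPolynomial σ ℝ →ₐ[ℝ] (ι → ℝ) :=
  AlgHom.pi fun i => MvPolynomial.aeval (x i)

theorem evalFamily_apply {ι σ : Type*} (x : ι → σ → ℝ) (F : MvPolynomial σ ℝ) (i : ι) :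
    evalFamily x F i = MvPolynomial.eval (x i) F := by
  simp [evalFamily, MvPolynomial.aeval_eq_eval]

theorem polyFunctionRing_le_range {V σ : Type*} [AddCommGroup V] [Module ℝ V] (S : Set V)
    (x : S → σ → ℝ)
    (h : ∀ ψ : Module.Dual ℝ V, ∃ F : MvPolynomial σ ℝ,
      ∀ s : S, MvPolynomial.eval (x s) F = ψ (s : V)) :
    polyFunctionRing S ≤ (evalFamily x).range := by
  refine Algebra.adjoin_le ?_
  rintro _ ⟨ψ, rfl⟩
  obtain ⟨F, hF⟩ := h ψ
  exact ⟨F, funext fun s => (evalFamily_apply x F s).trans (hF s)⟩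

/-- A set whose linear coordinates are polynomial functions of `N` parameters has dimension at
most `N`. -/
theorem semialgebraicDim_le_card {V σ : Type*} [AddCommGroup V] [Module ℝ V] [Module.Finite ℝ V]
    [Finite σ] (S : Set V) (x : S → σ → ℝ)
    (h : ∀ ψ : Module.Dual ℝ V, ∃ F : MvPolynomial σ ℝ,
      ∀ s : S, MvPolynomial.eval (x s) F = ψ (s : V)) :
    semialgebraicDim S ≤ (Nat.card σ : WithBot ℕ∞) := by
  unfold semialgebraicDim
  rcases subsingleton_or_nontrivial (polyFunctionRing S) with hS | hS
  · rw [ringKrullDim_eq_bot_of_subsingleton]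
    exact bot_le
  have := finiteType_polyFunctionRing S
  -- Noether normalization: the dimension is at most `r`. Lifting the `r` algebraically independent
  -- functions to polynomials in the parameters keeps them independent, so `r` is at most the number
  -- of parameters.
  obtain ⟨r, g, hg, hint⟩ := exists_integral_inj_algHom_of_fg ℝ (polyFunctionRing S)
  algebraize [g.toRingHom]
  have hdim := ringKrullDim_le_of_isIntegral (MvPolynomial (Fin r) ℝ) (polyFunctionRing S)
  rw [MvPolynomial.ringKrullDim_of_field, Nat.card_fin] at hdim
  refine hdim.trans ?_
  have hle := polyFunctionRing_le_range S x h
  choose f hf using fun i => hle (g (MvPolynomial.X i)).2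
  have hcomp : ∀ P, evalFamily x (MvPolynomial.aeval f P) = (g P : S → ℝ) := by
    intro P
    have : (evalFamily x).comp (MvPolynomial.aeval f) = (polyFunctionRing S).val.comp g := by
      ext1 i
      simpa using hf i
    exact DFunLike.congr_fun this P
  have hind : AlgebraicIndependent ℝ f := by
    intro P Q hPQ
    refine hg (Subtype.ext ?_)
    rw [← hcomp, ← hcomp]
    exact congrArg _ hPQ
  have hcard := hind.lift_cardinalMk_le_trdeg
  rw [MvPolynomial.trdeg_of_isDomain, Cardinal.lift_lift, ← Nat.cast_card (α := σ)] at hcard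
  have : r ≤ Nat.card σ := by simpa using hcard
  exact_mod_cast this

/-- A set with a Zariski-dense system of `N` linear coordinates that determine all linear
forms polynomially has dimension `N`. -/
theorem semialgebraicDim_eq_card {V σ : Type*} [AddCommGroup V] [Module ℝ V]
    [Finite σ] (S : Set V) (x : S → σ → ℝ)
    (h : ∀ ψ : Module.Dual ℝ V, ∃ F : MvPolynomial σ ℝ,
      ∀ s : S, MvPolynomial.eval (x s) F = ψ (s : V))
    (hx : ∀ i, ∃ ψ : Module.Dual ℝ V, ∀ s : S, ψ (s : V) = x s i)
    (hd : ∀ F : MvPolynomial σ ℝ, (∀ s, MvPolynomial.eval (x s) F = 0) → F = 0) :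
    semialgebraicDim S = (Nat.card σ : WithBot ℕ∞) := by
  have hinj : Function.Injective (evalFamily x) := by
    rw [injective_iff_map_eq_zero]
    intro F hF
    exact hd F fun s => by rw [← evalFamily_apply, hF]; rfl
  have hrange : (evalFamily x).range = polyFunctionRing S := by
    refine le_antisymm ?_ (polyFunctionRing_le_range S x h)
    rintro _ ⟨F, rfl⟩
    induction F using MvPolynomial.induction_on with
    | C a =>
      have := (polyFunctionRing S).algebraMap_mem a
      rwa [← (evalFamily x).commutes a] at this
    | add p q hp hq => simpa using add_mem hp hq
    | mul_X p i hp =>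
      obtain ⟨ψ, hψ⟩ := hx i
      have hX : evalFamily x (MvPolynomial.X i) ∈ polyFunctionRing S := by
        refine Algebra.subset_adjoin ⟨ψ, funext fun s => ?_⟩
        simp [evalFamily_apply, hψ]
      simpa using mul_mem hp hX
  unfold semialgebraicDim
  rw [← MvPolynomial.ringKrullDim_of_field σ ℝ, ← hrange]
  exact (ringKrullDim_eq_of_ringEquiv (AlgEquiv.ofInjective _ hinj).toRingEquiv).symm

/-! ### Compressing a representation to size `n * d` -/

theorem Submodule.finrank_iSup_le_sum {K V ι : Type*} [Field K] [AddCommGroup V] [Module K V]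
    [FiniteDimensional K V] [Fintype ι] (W : ι → Submodule K V) :
    Module.finrank K (⨆ i, W i : Submodule K V) ≤ ∑ i, Module.finrank K (W i) := by
  classical
  rw [← Finset.sup_univ_eq_iSup]
  refine Finset.induction_on Finset.univ (by simp) fun i s hi ih => ?_
  rw [Finset.sup_insert, Finset.sum_insert hi]
  exact (Submodule.finrank_add_le_finrank_add_finrank _ _).trans (by gcongr)

theorem Polynomial.natDegree_reverse_prod_X_sub_C {K ι : Type*} [Field K] [DecidableEq K]
    (s : Finset ι) (a : ι → K) :
    (∏ i ∈ s, (Polynomial.X - Polynomial.C (a i))).reverse.natDegree =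
      (s.filter fun i => a i ≠ 0).card := by
  classical
  induction s using Finset.induction_on with
  | empty => simp [← Polynomial.C_1, -map_one]
  | insert i s hi ih =>
    have hrev : (Polynomial.X - Polynomial.C (a i)).reverse =
        1 - Polynomial.C (a i) * Polynomial.X := by
      rw [sub_eq_add_neg, ← Polynomial.C_neg, Polynomial.reverse_add_C]
      have hX : (Polynomial.X : Polynomial K).reverse = 1 := by
        rw [← one_mul Polynomial.X, Polynomial.reverse_mul_X, ← Polynomial.C_1,
          Polynomial.reverse_C]
      simp [← sub_eq_add_neg, hX]
    have hne : (∏ i ∈ s, (Polynomial.X - Polynomial.C (a i))).reverse ≠ 0 := by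
      rw [Ne, Polynomial.reverse_eq_zero, Finset.prod_eq_zero_iff]
      rintro ⟨j, -, hj⟩
      exact Polynomial.X_sub_C_ne_zero _ hj
    have hne' : (1 - Polynomial.C (a i) * Polynomial.X : Polynomial K) ≠ 0 := by
      rw [← hrev, Ne, Polynomial.reverse_eq_zero]
      exact Polynomial.X_sub_C_ne_zero _
    rw [Finset.prod_insert hi, Polynomial.reverse_mul_of_domain, hrev,
      Polynomial.natDegree_mul hne' hne, ih, Finset.filter_insert]
    by_cases h : a i = 0
    · simp [h]
    · rw [if_pos h, Finset.card_insert_of_notMem (by simp [hi]), add_comm]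
      congr 1
      have : (1 - Polynomial.C (a i) * Polynomial.X : Polynomial K) =
          Polynomial.C (-a i) * Polynomial.X + Polynomial.C 1 := by simp; ring
      rw [this, Polynomial.natDegree_linear (neg_ne_zero.2 h)]

/-- Both sides count the nonzero eigenvalues. Diagonalizability is essential: a nilpotent matrix has
degree 0. -/
theorem Matrix.IsHermitian.natDegree_charpolyRev {ι : Type*} [Fintype ι] [DecidableEq ι]
    {A : Matrix ι ι ℂ} (hA : A.IsHermitian) : A.charpolyRev.natDegree = A.rank := by
  classical
  rw [← Matrix.reverse_charpoly, hA.charpoly_eq, Polynomial.natDegree_reverse_prod_X_sub_C,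
    hA.rank_eq_card_non_zero_eigs, Fintype.card_subtype]
  simp

theorem monicPencil_map {n k : ℕ} {R : Type*} [CommRing R] (M : Fin n → Matrix (Fin k) (Fin k) ℂ)
    (f : MvPolynomial (Fin n) ℂ →+* R) :
    f (monicPencil M).det = (1 + ∑ i, f (MvPolynomial.X i) •
      (M i).map (f.comp MvPolynomial.C)).det := by
  rw [RingHom.map_det, monicPencil]
  congr 1
  ext a b
  simp [Matrix.one_apply, Matrix.sum_apply, apply_ite f]

theorem rank_le_of_map_eq_det {n d k : ℕ} {p : MvPolynomial (Fin n) ℝ} (hp : p.totalDegree ≤ d)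
    {M : Fin n → Matrix (Fin k) (Fin k) ℂ} (hM : ∀ i, (M i).IsHermitian)
    (h : MvPolynomial.map (algebraMap ℝ ℂ) p = (monicPencil M).det) (i : Fin n) :
    (M i).rank ≤ d := by
  classical
  rw [← (hM i).natDegree_charpolyRev]
  -- The sign matches `charpolyRev`, which is `det (1 - X • M i)`.
  let y : Fin n → Polynomial ℂ := Pi.single i (-Polynomial.X)
  have key : (M i).charpolyRev = MvPolynomial.aeval y (MvPolynomial.map (algebraMap ℝ ℂ) p) := by
    rw [h, ← AlgHom.coe_toRingHom, monicPencil_map, Matrix.charpolyRev, sub_eq_add_neg]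
    congr 2
    rw [Finset.sum_eq_single i]
    · ext1 a b
      simp [y]
    · intro j _ hj
      simp [y, hj]
    · simp
  rw [key]
  have := MvPolynomial.aeval_natDegree_le (m := d) (n := 1)
    (MvPolynomial.map (algebraMap ℝ ℂ) p)
    ((Finset.sup_mono (MvPolynomial.support_map_subset _ _)).trans hp) y fun j => ?_
  · simpa using this
  · by_cases hj : j = i
    · subst hj; simp [y]
    · simp [y, hj]

/-- The columns of `V` are an orthonormal basis of the sum of the ranges, padded with zeros up to
`K`, so `V * V.conjTranspose` is the orthogonal projection onto that sum. -/
theorem exists_mul_conjTranspose_mul_eq {ι : Type*} [Fintype ι] {k K : ℕ}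
    (M : ι → Matrix (Fin k) (Fin k) ℂ) (hK : ∑ i, (M i).rank ≤ K) :
    ∃ V : Matrix (Fin k) (Fin K) ℂ, ∀ i, V * V.conjTranspose * M i = M i := by
  classical
  let e := (WithLp.linearEquiv 2 ℂ (Fin k → ℂ)).symm
  let W : Submodule ℂ (EuclideanSpace ℂ (Fin k)) :=
    (⨆ i, LinearMap.range (M i).mulVecLin : Submodule ℂ (Fin k → ℂ)).map e.toLinearMap
  have hW : Module.finrank ℂ W ≤ K := by
    rw [LinearEquiv.finrank_map_eq]
    exact (Submodule.finrank_iSup_le_sum _).trans hK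
  let b := stdOrthonormalBasis ℂ W
  let u : Fin K → EuclideanSpace ℂ (Fin k) := fun j =>
    if h : (j : ℕ) < Module.finrank ℂ W then (b ⟨j, h⟩ : EuclideanSpace ℂ (Fin k)) else 0
  have hu : ∀ w ∈ W, ∑ j, inner ℂ (u j) w • u j = w := by
    intro w hw
    have hb := congrArg (Subtype.val) (b.sum_repr' ⟨w, hw⟩)
    simp only [Submodule.coe_sum, Submodule.coe_smul, Submodule.coe_inner] at hb
    refine Eq.trans (Eq.symm ?_) hb
    refine Fintype.sum_of_injective (Fin.castLE hW) (Fin.castLE_injective hW) _ _ ?_ ?_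
    · intro j hj
      have : ¬ (j : ℕ) < Module.finrank ℂ W := fun h => hj ⟨⟨j, h⟩, rfl⟩
      simp [u, this]
    · intro j
      simp [u]
  refine ⟨Matrix.of fun a j => u j a, fun i => ?_⟩
  ext a c
  have hw : WithLp.toLp 2 (fun a => M i a c) ∈ W := by
    refine ⟨fun a => M i a c, Submodule.mem_iSup_of_mem i ⟨Pi.single c 1, ?_⟩, rfl⟩
    ext; simp
  have hb := congrArg (fun w : EuclideanSpace ℂ (Fin k) => w a) (hu _ hw)
  refine Eq.trans ?_ hb
  rw [Matrix.mul_assoc, Matrix.mul_apply]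
  simp only [WithLp.ofLp_sum, Finset.sum_apply]
  refine Finset.sum_congr rfl fun j _ => ?_
  simp [Matrix.mul_apply, EuclideanSpace.inner_eq_star_dotProduct, dotProduct, mul_comm]

/-- Sylvester's identity `det (1 + A * B) = det (1 + B * A)` with `A = V`. -/
theorem det_monicPencil_compress {n k K : ℕ} (M : Fin n → Matrix (Fin k) (Fin k) ℂ)
    (V : Matrix (Fin k) (Fin K) ℂ) (hV : ∀ i, V * V.conjTranspose * M i = M i) :
    (monicPencil fun i => V.conjTranspose * M i * V).det = (monicPencil M).det := by
  let c := (MvPolynomial.C : ℂ →+* MvPolynomial (Fin n) ℂ)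
  have h : ∑ i, (MvPolynomial.X i : MvPolynomial (Fin n) ℂ) • (M i).map c =
      V.map c * (V.conjTranspose.map c *
        ∑ i, (MvPolynomial.X i : MvPolynomial (Fin n) ℂ) • (M i).map c) := by
    rw [Matrix.mul_sum, Matrix.mul_sum]
    refine Finset.sum_congr rfl fun i _ => ?_
    rw [Matrix.mul_smul, Matrix.mul_smul, ← Matrix.map_mul, ← Matrix.map_mul, ← Matrix.mul_assoc,
      hV]
  rw [monicPencil, monicPencil, h, Matrix.det_one_add_mul_comm, Matrix.mul_sum, Matrix.sum_mul]
  congr 2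
  refine Finset.sum_congr rfl fun i _ => ?_
  rw [Matrix.mul_smul, Matrix.smul_mul, ← Matrix.map_mul, ← Matrix.map_mul]

/-- A polynomial of degree at most `d` in `n` variables with a determinantal representation has
one of size `n * d`. -/
theorem HasDetRepresentation.exists_size_eq {n d : ℕ} {p : MvPolynomial (Fin n) ℝ}
    (hp : p.totalDegree ≤ d) (h : HasDetRepresentation p) :
    ∃ M : Fin n → Matrix (Fin (n * d)) (Fin (n * d)) ℂ, (∀ i, (M i).IsHermitian) ∧
      MvPolynomial.map (algebraMap ℝ ℂ) p = (monicPencil M).det := by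
  obtain ⟨k, M, hM, hdet⟩ := h
  obtain ⟨V, hV⟩ := exists_mul_conjTranspose_mul_eq (K := n * d) M
    ((Finset.sum_le_card_nsmul _ _ d fun i _ => rank_le_of_map_eq_det hp hM hdet i).trans
      (by simp))
  refine ⟨fun i => V.conjTranspose * M i * V, fun i => ?_, ?_⟩
  · exact Matrix.isHermitian_conjTranspose_mul_mul V (hM i)
  · rw [det_monicPencil_compress M V hV, hdet]

/-! ### Real parameters for hermitian pencils -/

theorem exists_eval_eq_re_eval {σ : Type*} (G : MvPolynomial σ ℂ) :
    ∃ F : MvPolynomial σ ℝ, ∀ x : σ → ℝ,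
      MvPolynomial.eval x F = (MvPolynomial.eval (fun s => (x s : ℂ)) G).re := by
  induction G using MvPolynomial.induction_on with
  | C a => exact ⟨MvPolynomial.C a.re, by simp⟩
  | add p q hp hq =>
    obtain ⟨P, hP⟩ := hp
    obtain ⟨Q, hQ⟩ := hq
    exact ⟨P + Q, by simp [hP, hQ]⟩
  | mul_X p i hp =>
    obtain ⟨P, hP⟩ := hp
    exact ⟨P * MvPolynomial.X i, by simp [hP]⟩

/-- The generic tuple of hermitian matrices, with entries linear in real parameters. -/
noncomputable def genericHermitian (n K : ℕ) (i : Fin n) :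
    Matrix (Fin K) (Fin K) (MvPolynomial (Fin n × Fin K × Fin K) ℂ) :=
  Matrix.of fun a b => MvPolynomial.C (1 / 2) *
    ((MvPolynomial.X (i, a, b) + MvPolynomial.X (i, b, a)) +
      MvPolynomial.C Complex.I * (MvPolynomial.X (i, a, b) - MvPolynomial.X (i, b, a)))

/-- One real number `re + im` per entry suffices: by hermitian symmetry, the sum and difference over
`(a, b)` and `(b, a)` are twice the real and imaginary parts. Hence `K ^ 2` parameters per matrix.
-/
theorem genericHermitian_eval {n K : ℕ} {M : Fin n → Matrix (Fin K) (Fin K) ℂ}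
    (hM : ∀ i, (M i).IsHermitian) (i : Fin n) :
    (genericHermitian n K i).map (MvPolynomial.eval fun s =>
      (((M s.1 s.2.1 s.2.2).re + (M s.1 s.2.1 s.2.2).im : ℝ) : ℂ)) = M i := by
  ext a b
  have h : M i b a = star (M i a b) := ((hM i).apply b a).symm
  apply Complex.ext <;> simp [genericHermitian, h] <;> ring

theorem exists_eval_eq_coeff_det (n K : ℕ) (m : Fin n →₀ ℕ) :
    ∃ F : MvPolynomial (Fin n × Fin K × Fin K) ℝ,
      ∀ M : Fin n → Matrix (Fin K) (Fin K) ℂ, (∀ i, (M i).IsHermitian) →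
        MvPolynomial.eval (fun s => (M s.1 s.2.1 s.2.2).re + (M s.1 s.2.1 s.2.2).im) F =
          (MvPolynomial.coeff m (monicPencil M).det).re := by
  obtain ⟨F, hF⟩ := exists_eval_eq_re_eval (MvPolynomial.coeff m
    (1 + ∑ i, (MvPolynomial.X i : MvPolynomial (Fin n) (MvPolynomial (Fin n × Fin K × Fin K) ℂ)) •
      (genericHermitian n K i).map MvPolynomial.C).det)
  refine ⟨F, fun M hM => ?_⟩
  rw [hF, ← MvPolynomial.coeff_map, RingHom.map_det]
  congr 4
  rw [monicPencil]
  ext1 a b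
  have hg := fun i => congrFun (congrFun (genericHermitian_eval hM i) a) b
  simp only [Matrix.map_apply] at hg
  simp [Matrix.one_apply, Matrix.sum_apply, apply_ite (MvPolynomial.map _), ← hg]

/-! ### Coefficients as coordinates, and the upper bound -/

/-- The exponents of the monomials of total degree at most `d`. -/
def exponentsLE (n d : ℕ) : Finset (Fin n →₀ ℕ) :=
  (Finset.range (d + 1)).biUnion fun k => Finset.univ.finsuppAntidiag k

theorem mem_exponentsLE {n d : ℕ} {m : Fin n →₀ ℕ} : m ∈ exponentsLE n d ↔ m.degree ≤ d := by
  simp [exponentsLE, Finsupp.degree_eq_sum]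

theorem Nat.sum_range_multichoose_eq (n d : ℕ) :
    ∑ k ∈ Finset.range (d + 1), n.multichoose k = (n + 1).multichoose d := by
  induction d with
  | zero => simp
  | succ d ih => rw [Finset.sum_range_succ, ih, Nat.multichoose_succ_succ, add_comm]

theorem card_exponentsLE (n d : ℕ) : (exponentsLE n d).card = (n + d).choose d := by
  rw [exponentsLE, Finset.card_biUnion]
  · simp only [Finset.card_finsuppAntidiag_nat_eq_multichoose, Finset.card_univ, Fintype.card_fin]
    rw [Nat.sum_range_multichoose_eq, Nat.multichoose_eq]
    congr 1
    omega
  · intro j _ k _ hjk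
    rw [Function.onFun, Finset.disjoint_left]
    intro m hj hk
    exact hjk ((Finset.mem_finsuppAntidiag.1 hj).1.symm.trans (Finset.mem_finsuppAntidiag.1 hk).1)

theorem eq_sum_exponentsLE {n d : ℕ} {p : MvPolynomial (Fin n) ℝ} (hp : p ∈ PolyDeg n d) :
    p = ∑ m ∈ exponentsLE n d, MvPolynomial.monomial m (p.coeff m) := by
  conv_lhs => rw [p.as_sum]
  refine Finset.sum_subset (fun m hm => ?_) fun m _ hm => ?_
  · rw [mem_exponentsLE]
    exact (MvPolynomial.le_totalDegree hm).trans ((MvPolynomial.mem_restrictTotalDegree _ _ _).1 hp)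
  · rw [MvPolynomial.notMem_support_iff.1 hm, map_zero]

theorem sum_exponentsLE_mem {n d : ℕ} (c : (Fin n →₀ ℕ) → ℝ) :
    ∑ m ∈ exponentsLE n d, MvPolynomial.monomial m (c m) ∈ PolyDeg n d := by
  refine Submodule.sum_mem _ fun m hm => ?_
  rw [MvPolynomial.mem_restrictTotalDegree]
  exact (MvPolynomial.totalDegree_monomial_le _ _).trans (mem_exponentsLE.1 hm)

theorem exists_dual_eq_sum {n d : ℕ} (ψ : Module.Dual ℝ (PolyDeg n d)) :
    ∃ c : (Fin n →₀ ℕ) → ℝ, ∀ p : PolyDeg n d,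
      ψ p = ∑ m ∈ exponentsLE n d, c m * (p : MvPolynomial (Fin n) ℝ).coeff m := by
  obtain ⟨ψ', hψ'⟩ := LinearMap.exists_extend ψ
  refine ⟨fun m => ψ' (MvPolynomial.monomial m 1), fun p => ?_⟩
  rw [← hψ', LinearMap.comp_apply, Submodule.subtype_apply]
  conv_lhs => rw [eq_sum_exponentsLE p.2]
  rw [map_sum]
  refine Finset.sum_congr rfl fun m _ => ?_
  rw [mul_comm, ← smul_eq_mul, ← map_smul, MvPolynomial.smul_monomial, smul_eq_mul, mul_one]

theorem semialgebraicDim_detSet_le (n d : ℕ) :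
    semialgebraicDim (detSet n d) ≤ ((n ^ 3 * d ^ 2 : ℕ) : WithBot ℕ∞) := by
  have hrep : ∀ p : detSet n d, ∃ M : Fin n → Matrix (Fin (n * d)) (Fin (n * d)) ℂ,
      (∀ i, (M i).IsHermitian) ∧ MvPolynomial.map (algebraMap ℝ ℂ) (p : PolyDeg n d) =
        (monicPencil M).det := fun p =>
    p.2.2.exists_size_eq ((MvPolynomial.mem_restrictTotalDegree _ _ _).1 p.1.2)
  choose M hM hdet using hrep
  have h := semialgebraicDim_le_card (detSet n d)
    (fun p (s : Fin n × Fin (n * d) × Fin (n * d)) =>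
      (M p s.1 s.2.1 s.2.2).re + (M p s.1 s.2.1 s.2.2).im) fun ψ => by
    obtain ⟨c, hc⟩ := exists_dual_eq_sum ψ
    choose F hF using exists_eval_eq_coeff_det n (n * d)
    refine ⟨∑ m ∈ exponentsLE n d, MvPolynomial.C (c m) * F m, fun p => ?_⟩
    rw [map_sum, hc]
    refine Finset.sum_congr rfl fun m _ => ?_
    rw [map_mul, MvPolynomial.eval_C, hF m _ (hM p), ← hdet, MvPolynomial.coeff_map]
    simp
  convert h using 3
  simp
  ring

/-! ### Real-rootedness near a product with distinct integer roots -/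

theorem mul_pos_of_abs_sub_lt {q f c : ℝ} (h : |q - f| < c) (hc : c ≤ |f|) : 0 < q * f := by
  rcases abs_cases f with ⟨h1, h2⟩ | ⟨h1, h2⟩ <;> rw [abs_lt] at h <;> nlinarith

theorem half_le_abs_int_add_half (k : ℤ) : (1 / 2 : ℝ) ≤ |(k : ℝ) + 1 / 2| := by
  rcases le_or_gt 0 k with h | h
  · have : (0 : ℝ) ≤ k := by exact_mod_cast h
    rw [abs_of_nonneg (by linarith)]
    linarith
  · have : (k : ℝ) ≤ -1 := by exact_mod_cast Int.le_sub_one_of_lt h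
    rw [abs_of_nonpos (by linarith)]
    linarith

theorem half_le_abs_int_sub_half (k : ℤ) : (1 / 2 : ℝ) ≤ |(k : ℝ) - 1 / 2| := by
  have := half_le_abs_int_add_half (k - 1)
  push_cast at this
  convert this using 2
  ring

theorem half_pow_le_abs_prod (S : Finset ℤ) (f : ℤ → ℝ) (h : ∀ s ∈ S, 1 / 2 ≤ |f s|) :
    (1 / 2 : ℝ) ^ S.card ≤ |∏ s ∈ S, f s| := by
  rw [Finset.abs_prod, ← Finset.prod_const]
  exact Finset.prod_le_prod (fun _ _ => by norm_num) h

/-- Paired by `s`, the factors are `(r - s) ^ 2 - 1 / 4`, negative only for `s = r`. -/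
theorem prod_half_mul_prod_half_neg {S : Finset ℤ} {r : ℤ} (hr : r ∈ S) :
    (∏ s ∈ S, ((r : ℝ) - 1 / 2 - s)) * ∏ s ∈ S, ((r : ℝ) + 1 / 2 - s) < 0 := by
  rw [← Finset.prod_mul_distrib, ← Finset.mul_prod_erase S _ hr]
  refine mul_neg_of_neg_of_pos (by ring_nf; norm_num) (Finset.prod_pos fun s hs => ?_)
  have h1 : (1 : ℝ) ≤ |(r : ℝ) - s| := by
    have : (1 : ℤ) ≤ |r - s| := Int.one_le_abs (sub_ne_zero.2 (Finset.ne_of_mem_erase hs).symm)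
    exact_mod_cast this
  have h2 : 1 ≤ ((r : ℝ) - s) ^ 2 := by
    rw [← sq_abs]
    nlinarith
  nlinarith

/-- A monic real polynomial whose degree is the number of its distinct real roots has only real
complex roots. -/
theorem Polynomial.im_eq_zero_of_card_le_roots {Q : Polynomial ℝ} (hQ : Q ≠ 0) (R : Finset ℝ)
    (hR : ∀ x ∈ R, Q.eval x = 0) (hcard : Q.natDegree ≤ R.card) {z : ℂ}
    (hz : Polynomial.aeval z Q = 0) : z.im = 0 := by
  have hle : R.val ≤ Q.roots := by
    rw [Multiset.le_iff_subset R.nodup]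
    intro x hx
    rw [Polynomial.mem_roots hQ]
    exact hR x hx
  have hc : Multiset.card Q.roots = Q.natDegree :=
    le_antisymm (Polynomial.card_roots' Q) (hcard.trans (Multiset.card_le_card hle))
  rw [← Polynomial.C_leadingCoeff_mul_prod_multiset_X_sub_C hc] at hz
  have h0 : Q.leadingCoeff ≠ 0 := Polynomial.leadingCoeff_ne_zero.2 hQ
  simp only [map_mul, Polynomial.aeval_C, mul_eq_zero, map_multiset_prod,
    Multiset.map_map, Multiset.prod_eq_zero_iff] at hz
  rcases hz with hz | hz
  · simp [hQ] at hz
  · obtain ⟨x, -, hx⟩ := Multiset.mem_map.1 hz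
    simp only [Function.comp_apply, map_sub, Polynomial.aeval_X, Polynomial.aeval_C,
      sub_eq_zero] at hx
    rw [hx]
    simp

/-- At half-integers the product is at least `(1 / 2) ^ S.card` in absolute value, so `Q` has its
sign there and changes sign across each `r ∈ S`. The resulting roots lie in disjoint open intervals
and exhaust the degree. -/
theorem Polynomial.im_eq_zero_of_near_prod {Q : Polynomial ℝ} {S : Finset ℤ} (hQ : Q ≠ 0)
    (hdeg : Q.natDegree ≤ S.card)
    (hm : ∀ r ∈ S, |Q.eval ((r : ℝ) - 1 / 2) - ∏ s ∈ S, ((r : ℝ) - 1 / 2 - s)| <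
      (1 / 2) ^ S.card)
    (hp : ∀ r ∈ S, |Q.eval ((r : ℝ) + 1 / 2) - ∏ s ∈ S, ((r : ℝ) + 1 / 2 - s)| <
      (1 / 2) ^ S.card)
    {z : ℂ} (hz : Polynomial.aeval z Q = 0) : z.im = 0 := by
  have hroot : ∀ r ∈ S, ∃ x : ℝ, |x - r| < 1 / 2 ∧ Q.eval x = 0 := by
    intro r hr
    have h1 := mul_pos_of_abs_sub_lt (hm r hr) (half_pow_le_abs_prod S _ fun s _ => by
      have := half_le_abs_int_sub_half (r - s)
      push_cast at this
      rwa [sub_right_comm])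
    have h2 := mul_pos_of_abs_sub_lt (hp r hr) (half_pow_le_abs_prod S _ fun s _ => by
      have := half_le_abs_int_add_half (r - s)
      push_cast at this
      rwa [add_sub_right_comm])
    have h3 := prod_half_mul_prod_half_neg hr
    have h4 : Q.eval ((r : ℝ) - 1 / 2) * Q.eval ((r : ℝ) + 1 / 2) < 0 := by
      have h5 := mul_pos h1 h2
      rw [mul_mul_mul_comm] at h5
      exact neg_of_mul_pos_left h5 h3.le
    have h0 : (0 : ℝ) ∈ Set.uIcc (Q.eval ((r : ℝ) - 1 / 2)) (Q.eval ((r : ℝ) + 1 / 2)) := by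
      rw [Set.mem_uIcc]
      rcases mul_neg_iff.1 h4 with h | h
      · exact Or.inr ⟨h.2.le, h.1.le⟩
      · exact Or.inl ⟨h.1.le, h.2.le⟩
    obtain ⟨x, hx, hx0⟩ := intermediate_value_uIcc Q.continuous.continuousOn h0
    rw [Set.uIcc_of_le (by linarith)] at hx
    replace hx0 : Q.eval x = 0 := hx0
    refine ⟨x, ?_, hx0⟩
    have hl : x ≠ r - 1 / 2 := by rintro rfl; simp only [hx0, zero_mul, lt_self_iff_false] at h4
    have hu : x ≠ r + 1 / 2 := by rintro rfl; simp only [hx0, mul_zero, lt_self_iff_false] at h4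
    have hl' := lt_of_le_of_ne hx.1 hl.symm
    have hu' := lt_of_le_of_ne hx.2 hu
    rw [abs_lt]
    constructor <;> linarith
  choose! x hx hx0 using hroot
  have hinj : Set.InjOn x S := by
    intro r hr s hs hrs
    have h1 := hx r hr
    have h2 := hx s hs
    rw [hrs] at h1
    have h3 : |((r - s : ℤ) : ℝ)| < 1 := by
      push_cast
      rw [abs_lt] at *
      constructor <;> linarith
    have h4 : |r - s| < 1 := by exact_mod_cast h3
    exact sub_eq_zero.1 (Int.abs_lt_one_iff.1 h4)
  refine Polynomial.im_eq_zero_of_card_le_roots hQ (S.image x) ?_ ?_ hz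
  · intro y hy
    obtain ⟨r, hr, rfl⟩ := Finset.mem_image.1 hy
    exact hx0 r hr
  · rwa [Finset.card_image_of_injOn hinj]

/-! ### A box of real zero polynomials -/

/-- The univariate polynomial `t ^ d * p (a / t)`. -/
noncomputable def reversedRestriction {n : ℕ} (d : ℕ) (p : MvPolynomial (Fin n) ℝ)
    (a : Fin n → ℝ) : Polynomial ℝ :=
  ∑ m ∈ exponentsLE n d,
    Polynomial.C (p.coeff m * m.prod fun i k => a i ^ k) * Polynomial.X ^ (d - m.degree)

theorem aeval_reversedRestriction {n d : ℕ} {p : MvPolynomial (Fin n) ℝ} (hp : p ∈ PolyDeg n d)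
    (a : Fin n → ℝ) {K : Type*} [Field K] [Algebra ℝ K] {t : K} (ht : t ≠ 0) :
    Polynomial.aeval t (reversedRestriction d p a) =
      t ^ d * MvPolynomial.aeval (fun i => t⁻¹ * algebraMap ℝ K (a i)) p := by
  conv_rhs => rw [eq_sum_exponentsLE hp]
  rw [reversedRestriction, map_sum, map_sum, Finset.mul_sum]
  refine Finset.sum_congr rfl fun m hm => ?_
  have hprod : (m.prod fun i k => (t⁻¹ * algebraMap ℝ K (a i)) ^ k) =
      t⁻¹ ^ m.degree * algebraMap ℝ K (m.prod fun i k => a i ^ k) := by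
    simp only [Finsupp.prod, mul_pow, Finset.prod_mul_distrib, Finset.prod_pow_eq_pow_sum,
      map_prod, map_pow]
    rfl
  rw [MvPolynomial.aeval_monomial, hprod, map_mul, Polynomial.aeval_C, map_pow,
    Polynomial.aeval_X, map_mul, pow_sub₀ t ht (mem_exponentsLE.1 hm), inv_pow]
  ring

theorem reversedRestriction_eq_X_pow_add {n d : ℕ} {p : MvPolynomial (Fin n) ℝ}
    (h0 : p.coeff 0 = 1) (a : Fin n → ℝ) :
    ∃ q : Polynomial ℝ, q.degree < d ∧ reversedRestriction d p a = Polynomial.X ^ d + q := by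
  refine ⟨∑ m ∈ (exponentsLE n d).erase 0,
    Polynomial.C (p.coeff m * m.prod fun i k => a i ^ k) * Polynomial.X ^ (d - m.degree), ?_, ?_⟩
  · rw [← Polynomial.mem_degreeLT]
    refine Submodule.sum_mem _ fun m hm => ?_
    rw [Polynomial.mem_degreeLT]
    refine (Polynomial.degree_C_mul_X_pow_le _ _).trans_lt ?_
    rw [Finset.mem_erase, mem_exponentsLE] at hm
    have : m.degree ≠ 0 := by
      rw [Ne, Finsupp.degree_eq_zero_iff]
      exact hm.1
    exact_mod_cast (by omega : d - m.degree < d)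
  · have hmem : (0 : Fin n →₀ ℕ) ∈ exponentsLE n d := mem_exponentsLE.2 (by simp)
    rw [reversedRestriction, ← Finset.add_sum_erase _ _ hmem]
    simp [h0]

/-- With `ρ` the norm of `a ≠ 0`, a zero `μ` along `a` gives the root `(μ * ρ)⁻¹` of the reversed
restriction to the unit vector `a / ρ`. -/
theorem isRealZero_of_reversedRestriction {n d : ℕ} {p : MvPolynomial (Fin n) ℝ}
    (hp : p ∈ PolyDeg n d) (h0 : p.coeff 0 = 1)
    (h : ∀ a : Fin n → ℝ, ∑ i, a i ^ 2 = 1 → ∀ z : ℂ,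
      Polynomial.aeval z (reversedRestriction d p a) = 0 → z.im = 0) : IsRealZero p := by
  have heval : MvPolynomial.eval 0 p = 1 := by
    rw [← h0, MvPolynomial.eval_zero, MvPolynomial.constantCoeff_eq]
  refine ⟨heval, fun a μ hμ => ?_⟩
  by_cases hμ0 : μ = 0
  · simp [hμ0]
  by_cases ha : a = 0
  · exfalso
    subst ha
    have h1 : MvPolynomial.aeval (fun i : Fin n => μ * (((0 : Fin n → ℝ) i : ℝ) : ℂ)) p =
        ((MvPolynomial.eval 0 p : ℝ) : ℂ) := by
      rw [← MvPolynomial.aeval_eq_eval, ← Complex.coe_algebraMap,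
        ← MvPolynomial.aeval_algebraMap_apply]
      congr 2
      funext i
      simp
    rw [h1, heval] at hμ
    simp at hμ
  have hpos : 0 < ∑ i, a i ^ 2 := by
    obtain ⟨i, hi⟩ := Function.ne_iff.1 ha
    exact Finset.sum_pos' (fun _ _ => sq_nonneg _)
      ⟨i, Finset.mem_univ i, sq_pos_iff.2 hi⟩
  set ρ := √(∑ i, a i ^ 2) with hρ
  have hρ0 : 0 < ρ := Real.sqrt_pos.2 hpos
  have hρ2 : ρ ^ 2 = ∑ i, a i ^ 2 := Real.sq_sqrt hpos.le
  have hρc : (ρ : ℂ) ≠ 0 := by exact_mod_cast hρ0.ne'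
  have hb : ∑ i, (a i / ρ) ^ 2 = 1 := by
    simp only [div_pow]
    rw [← Finset.sum_div, hρ2, div_self hpos.ne']
  have hz := h (fun i => a i / ρ) hb (μ * ρ)⁻¹ (by
    rw [aeval_reversedRestriction hp _ (inv_ne_zero (mul_ne_zero hμ0 hρc))]
    refine mul_eq_zero_of_right _ ?_
    rw [← hμ]
    congr 2
    funext i
    rw [Complex.coe_algebraMap, Complex.ofReal_div]
    field_simp)
  have hμ' : μ = (((((μ * ρ)⁻¹ : ℂ).re)⁻¹ / ρ : ℝ) : ℂ) := by
    have hre : ((((μ * ρ)⁻¹ : ℂ).re : ℝ) : ℂ) = (μ * ρ)⁻¹ :=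
      Complex.ext (Complex.ofReal_re _) (by rw [hz, Complex.ofReal_im])
    rw [Complex.ofReal_div, Complex.ofReal_inv, hre]
    field_simp
  rw [hμ']
  exact Complex.ofReal_im _

/-- A product of polynomials `1 - k² ∑ xᵢ²`: for every unit vector `a`, the polynomial
`t ^ d * p (a / t)` is a product of `d` distinct factors `t - s` with `s` an integer. -/
theorem exists_sphere_product (n d : ℕ) :
    ∃ (p : MvPolynomial (Fin n) ℝ) (S : Finset ℤ), p ∈ PolyDeg n d ∧ p.coeff 0 = 1 ∧
      S.card = d ∧ (∀ s ∈ S, |s| ≤ d) ∧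
      ∀ a : Fin n → ℝ, ∑ i, a i ^ 2 = 1 → ∀ t : ℝ, t ≠ 0 →
        t ^ d * MvPolynomial.aeval (fun i => t⁻¹ * a i) p = ∏ s ∈ S, (t - s) := by
  simp only [MvPolynomial.mem_restrictTotalDegree]
  induction d using Nat.twoStepInduction with
  | zero => exact ⟨1, ∅, by simp⟩
  -- For odd `d` the root 0 comes from reversing with respect to `d` rather than to the actual
  -- degree.
  | one => exact ⟨1, {0}, by simp⟩
  | more d ih _ =>
    obtain ⟨p, S, hp, h0, hcard, hS, h⟩ := ih
    have hm : -((d : ℤ) + 1) ∉ S := fun hs => by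
      have := hS _ hs
      rw [abs_le] at this
      omega
    have hm' : ((d : ℤ) + 1) ∉ insert (-((d : ℤ) + 1)) S := by
      rw [Finset.mem_insert]
      rintro (hs | hs)
      · omega
      · have := hS _ hs
        rw [abs_le] at this
        omega
    refine ⟨p * (1 - MvPolynomial.C (((d : ℝ) + 1) ^ 2) * ∑ i, MvPolynomial.X i ^ 2),
      insert ((d : ℤ) + 1) (insert (-((d : ℤ) + 1)) S), ?_, ?_, ?_, ?_, ?_⟩
    · refine (MvPolynomial.totalDegree_mul _ _).trans (add_le_add hp ?_)
      refine (MvPolynomial.totalDegree_sub _ _).trans (max_le (by simp) ?_)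
      refine (MvPolynomial.totalDegree_mul _ _).trans ?_
      rw [MvPolynomial.totalDegree_C, zero_add]
      refine MvPolynomial.totalDegree_finsetSum_le fun i _ => ?_
      rw [MvPolynomial.totalDegree_X_pow]
    · rw [← MvPolynomial.constantCoeff_eq] at h0 ⊢
      simp [h0]
    · rw [Finset.card_insert_of_notMem hm', Finset.card_insert_of_notMem hm, hcard]
    · intro s hs
      rw [Finset.mem_insert, Finset.mem_insert] at hs
      rw [abs_le]
      rcases hs with rfl | rfl | hs
      · push_cast; constructor <;> omega
      · push_cast; constructor <;> omega
      · have := hS _ hs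
        rw [abs_le] at this
        push_cast; constructor <;> omega
    · intro a ha t ht
      rw [Finset.prod_insert hm', Finset.prod_insert hm, ← h a ha t ht]
      have hq : MvPolynomial.aeval (fun i => t⁻¹ * a i)
          (∑ i, MvPolynomial.X i ^ 2 : MvPolynomial (Fin n) ℝ) = t⁻¹ ^ 2 := by
        simp only [map_sum, map_pow, MvPolynomial.aeval_X, mul_pow]
        rw [← Finset.mul_sum, ha, mul_one]
      rw [map_mul, map_sub, map_mul, hq, map_one, MvPolynomial.aeval_C]
      simp only [Algebra.algebraMap_self, RingHom.id_apply]
      push_cast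
      field_simp
      ring

theorem exists_isRealZero_of_near (n d : ℕ) :
    ∃ (p₀ : MvPolynomial (Fin n) ℝ) (ε : ℝ), 0 < ε ∧ p₀.coeff 0 = 1 ∧
      ∀ p ∈ PolyDeg n d, p.coeff 0 = 1 →
        (∀ m ∈ exponentsLE n d, |p.coeff m - p₀.coeff m| < ε) → IsRealZero p := by
  obtain ⟨p₀, S, hp₀, h0, hcard, hS, hprod⟩ := exists_sphere_product n d
  have hc : 0 < ((exponentsLE n d).card : ℝ) := by
    have : (0 : Fin n →₀ ℕ) ∈ exponentsLE n d := mem_exponentsLE.2 (by simp)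
    exact_mod_cast Finset.card_pos.2 ⟨_, this⟩
  have hR : 0 < ((d : ℝ) + 1) ^ d := by positivity
  -- On the unit sphere each monomial in `a` is at most 1, and the powers of `t` are at most `(d +
  -- 1) ^ d` at the points `r ± 1 / 2`. Summing over all monomials keeps the error below `(1 / 2) ^
  -- d`.
  refine ⟨p₀, (1 / 2) ^ d / ((exponentsLE n d).card * ((d : ℝ) + 1) ^ d), by positivity,
    h0, fun p hp hp0 hnear => ?_⟩
  refine isRealZero_of_reversedRestriction hp hp0 fun a ha z hz => ?_
  obtain ⟨q, hq, hpq⟩ := reversedRestriction_eq_X_pow_add (d := d) hp0 a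
  have hdeg : (reversedRestriction d p a).natDegree = d := by
    rw [hpq, Polynomial.natDegree_add_eq_left_of_degree_lt (by rwa [Polynomial.degree_X_pow]),
      Polynomial.natDegree_X_pow]
  have hne : reversedRestriction d p a ≠ 0 := by
    rw [hpq]
    exact (Polynomial.monic_X_pow_add hq).ne_zero
  have hai : ∀ i, |a i| ≤ 1 := fun i => by
    rw [← sq_le_one_iff_abs_le_one, ← ha]
    exact Finset.single_le_sum (f := fun i => a i ^ 2) (fun _ _ => sq_nonneg _)
      (Finset.mem_univ i)
  have key : ∀ t : ℝ, t ≠ 0 → |t| ≤ d + 1 →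
      |(reversedRestriction d p a).eval t - ∏ s ∈ S, (t - s)| < (1 / 2) ^ S.card := by
    intro t ht htd
    have h1 := aeval_reversedRestriction hp₀ a ht
    simp only [Algebra.algebraMap_self, RingHom.id_apply] at h1
    rw [← hprod a ha t ht, ← h1, Polynomial.coe_aeval_eq_eval, reversedRestriction,
      reversedRestriction, Polynomial.eval_finsetSum, Polynomial.eval_finsetSum,
      ← Finset.sum_sub_distrib, hcard]
    refine (Finset.abs_sum_le_sum_abs _ _).trans_lt ?_
    have hterm : ∀ m ∈ exponentsLE n d,
        |(Polynomial.C (p.coeff m * m.prod fun i k => a i ^ k) *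
            Polynomial.X ^ (d - m.degree)).eval t -
          (Polynomial.C (p₀.coeff m * m.prod fun i k => a i ^ k) *
            Polynomial.X ^ (d - m.degree)).eval t| <
        (1 / 2 : ℝ) ^ d / (exponentsLE n d).card := by
      intro m hm
      simp only [Polynomial.eval_mul, Polynomial.eval_C, Polynomial.eval_pow, Polynomial.eval_X]
      rw [← sub_mul, ← sub_mul, abs_mul, abs_mul, abs_pow]
      have h2 : |m.prod fun i k => a i ^ k| ≤ 1 := by
        rw [Finsupp.prod, Finset.abs_prod]
        refine Finset.prod_le_one (fun _ _ => abs_nonneg _) fun i _ => ?_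
        rw [abs_pow]
        exact pow_le_one₀ (abs_nonneg _) (hai i)
      have h3 : |t| ^ (d - m.degree) ≤ ((d : ℝ) + 1) ^ d :=
        (pow_le_pow_left₀ (abs_nonneg _) htd _).trans
          (pow_le_pow_right₀ (by linarith [d.cast_nonneg (α := ℝ)]) (Nat.sub_le _ _))
      calc |p.coeff m - p₀.coeff m| * |m.prod fun i k => a i ^ k| * |t| ^ (d - m.degree)
          ≤ |p.coeff m - p₀.coeff m| * 1 * ((d : ℝ) + 1) ^ d := by gcongr
        _ < (1 / 2) ^ d / ((exponentsLE n d).card * ((d : ℝ) + 1) ^ d) * 1 *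
              ((d : ℝ) + 1) ^ d := by gcongr; exact hnear m hm
        _ = (1 / 2) ^ d / (exponentsLE n d).card := by field_simp
    refine (Finset.sum_lt_sum_of_nonempty (Finset.card_pos.1 (by exact_mod_cast hc))
      hterm).trans_eq ?_
    rw [Finset.sum_const, nsmul_eq_mul]
    field_simp
  have hSabs : ∀ r ∈ S, |(r : ℝ)| ≤ d := fun r hr => by exact_mod_cast hS r hr
  refine Polynomial.im_eq_zero_of_near_prod (S := S) hne (by rw [hdeg, hcard]) ?_ ?_ hz
  · intro r hr
    have h1 := half_le_abs_int_sub_half r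
    refine key _ (abs_pos.1 (by linarith)) ?_
    have := abs_le.1 (hSabs r hr)
    rw [abs_le]
    constructor <;> linarith
  · intro r hr
    have h1 := half_le_abs_int_add_half r
    refine key _ (abs_pos.1 (by linarith)) ?_
    have := abs_le.1 (hSabs r hr)
    rw [abs_le]
    constructor <;> linarith

/-! ### Dimension of the set of real zero polynomials -/

theorem semialgebraicDim_realZeroSet (n d : ℕ) :
    semialgebraicDim (realZeroSet n d) = (((n + d).choose d - 1 : ℕ) : WithBot ℕ∞) := by
  have hmem : (0 : Fin n →₀ ℕ) ∈ exponentsLE n d := mem_exponentsLE.2 (by simp)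
  have hcoeff0 : ∀ p : realZeroSet n d, (p.1 : MvPolynomial (Fin n) ℝ).coeff 0 = 1 := fun p => by
    have h := p.2.1
    rw [← MvPolynomial.constantCoeff_eq]
    rwa [MvPolynomial.eval_zero] at h
  obtain ⟨p₀, ε, hε, hp₀, hnear⟩ := exists_isRealZero_of_near n d
  have h := semialgebraicDim_eq_card (σ := (exponentsLE n d).erase 0) (realZeroSet n d)
    (fun p m => (p.1 : MvPolynomial (Fin n) ℝ).coeff m) ?_ ?_ ?_
  · rw [h, Nat.card_eq_fintype_card, Fintype.card_coe, Finset.card_erase_of_mem hmem,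
      card_exponentsLE]
  · intro ψ
    obtain ⟨c, hc⟩ := exists_dual_eq_sum ψ
    refine ⟨MvPolynomial.C (c 0) +
      ∑ m : (exponentsLE n d).erase 0, MvPolynomial.C (c m) * MvPolynomial.X m, fun p => ?_⟩
    rw [hc, ← Finset.add_sum_erase _ _ hmem, hcoeff0, mul_one, ← Finset.sum_coe_sort ((exponentsLE n d).erase 0)
      fun m => c m * (p.1 : MvPolynomial (Fin n) ℝ).coeff m]
    simp
  · exact fun m => ⟨(MvPolynomial.lcoeff ℝ (m : Fin n →₀ ℕ)).comp (Submodule.subtype _),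
      fun p => rfl⟩
  · intro F hF
    -- A polynomial vanishing on a product of infinite sets is zero; every point of this box comes
    -- from a real zero polynomial.
    refine MvPolynomial.funext_set (fun m => Set.Ioo (p₀.coeff m - ε) (p₀.coeff m + ε))
      (fun m => Set.Ioo_infinite (by linarith)) fun y hy => ?_
    classical
    let c : (Fin n →₀ ℕ) → ℝ := fun m =>
      if h : m ∈ (exponentsLE n d).erase 0 then y ⟨m, h⟩ else p₀.coeff m
    let p : MvPolynomial (Fin n) ℝ := ∑ m ∈ exponentsLE n d, MvPolynomial.monomial m (c m)
    have hp : ∀ m ∈ exponentsLE n d, p.coeff m = c m := by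
      intro m hm
      simp [p, MvPolynomial.coeff_sum, MvPolynomial.coeff_monomial, hm]
    have hy' : ∀ m : (exponentsLE n d).erase 0, p.coeff m = y m := by
      intro m
      rw [hp m (Finset.mem_of_mem_erase m.2)]
      simp only [c, dif_pos m.2]
    have hrz : IsRealZero p := by
      refine hnear p (sum_exponentsLE_mem c) ?_ fun m hm => ?_
      · rw [hp 0 hmem]
        simp [c, hp₀]
      · rw [hp m hm]
        by_cases h : m ∈ (exponentsLE n d).erase 0
        · have := hy ⟨m, h⟩ (Set.mem_univ _)
          simp only [c, dif_pos h]
          rw [abs_lt]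
          constructor <;> linarith [this.1, this.2]
        · simpa only [c, dif_neg h, sub_self, abs_zero] using hε
    rw [map_zero, ← hF ⟨⟨p, sum_exponentsLE_mem c⟩, hrz⟩]
    congr 2
    exact funext fun m => (hy' m).symm

/-! ### Binomial estimates and conclusion -/

theorem pow_lt_choose_of_le_left {n d : ℕ} (hd : 4 ≤ d) (hn : 24 * d ^ 2 ≤ n) :
    n ^ 3 * d ^ 2 < (n + d).choose d - 1 := by
  have h1 : (n + 4).choose 4 ≤ (n + d).choose d := by
    rw [← Nat.choose_symm_add (a := n) (b := 4), ← Nat.choose_symm_add (a := n) (b := d)]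
    exact Nat.choose_le_choose n (by omega)
  have h2 : (n + 1) ^ 4 ≤ 24 * (n + 4).choose 4 := by
    have := Nat.pow_sub_le_descFactorial (n + 4) 4
    rwa [Nat.descFactorial_eq_factorial_mul_choose] at this
  have h3 : (24 * d ^ 2 + 1) * (n + 1) ^ 3 ≤ (n + 1) * (n + 1) ^ 3 :=
    Nat.mul_le_mul_right _ (by omega)
  have h4 : n ^ 3 * d ^ 2 ≤ (n + 1) ^ 3 * d ^ 2 := by gcongr; omega
  -- Slack that absorbs the `- 1` in the goal, after division by 24.
  have h5 : 5 ^ 3 ≤ (n + 1) ^ 3 := by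
    gcongr
    nlinarith
  have h6 : (24 * d ^ 2 + 1) * (n + 1) ^ 3 = 24 * ((n + 1) ^ 3 * d ^ 2) + (n + 1) ^ 3 := by ring
  have h7 : (n + 1) * (n + 1) ^ 3 = (n + 1) ^ 4 := by ring
  omega

theorem pow_lt_choose_of_le_right {n d : ℕ} (hn : 3 ≤ n) (hd : 6 * n ^ 3 ≤ d) :
    n ^ 3 * d ^ 2 < (n + d).choose d - 1 := by
  have h1 : (d + 3).choose 3 ≤ (n + d).choose d := by
    rw [← Nat.choose_symm_add (a := d) (b := 3)]
    exact Nat.choose_le_choose d (by omega)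
  have h2 : (d + 1) ^ 3 ≤ 6 * (d + 3).choose 3 := by
    have := Nat.pow_sub_le_descFactorial (d + 3) 3
    rwa [Nat.descFactorial_eq_factorial_mul_choose] at this
  have h3 : (6 * n ^ 3 + 1) * (d + 1) ^ 2 ≤ (d + 1) * (d + 1) ^ 2 :=
    Nat.mul_le_mul_right _ (by omega)
  have h4 : n ^ 3 * d ^ 2 ≤ n ^ 3 * (d + 1) ^ 2 := by gcongr; omega
  have h0 : 3 ^ 3 ≤ n ^ 3 := by gcongr
  have h5 : 5 ^ 2 ≤ (d + 1) ^ 2 := by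
    gcongr
    omega
  have h6 : (6 * n ^ 3 + 1) * (d + 1) ^ 2 = 6 * (n ^ 3 * (d + 1) ^ 2) + (d + 1) ^ 2 := by ring
  have h7 : (d + 1) * (d + 1) ^ 2 = (d + 1) ^ 3 := by ring
  omega

theorem almostNoDetRepresentation_of_lt {n d : ℕ} (h : n ^ 3 * d ^ 2 < (n + d).choose d - 1) :
    AlmostNoDetRepresentation n d := by
  refine (semialgebraicDim_detSet_le n d).trans_lt ?_
  rw [semialgebraicDim_realZeroSet]
  exact_mod_cast h

theorem AlmostNoDetRepresentation.exists_notMem {n d : ℕ} (h : AlmostNoDetRepresentation n d) :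
    ∃ p ∈ realZeroSet n d, p ∉ detSet n d := by
  by_contra! hall
  have : detSet n d = realZeroSet n d :=
    Set.Subset.antisymm (fun p hp => hp.1) hall
  rw [AlmostNoDetRepresentation, this] at h
  exact h.false

theorem mainTheorem2 :
    (∀ d : ℕ, 4 ≤ d → ∃ n₀ : ℕ, ∀ n : ℕ, n₀ ≤ n →
      semialgebraicDim (realZeroSet n d) = (((n + d).choose d - 1 : ℕ) : WithBot ℕ∞) ∧
      n ^ 3 * d ^ 2 < (n + d).choose d - 1 ∧
      semialgebraicDim (detSet n d) ≤ ((n ^ 3 * d ^ 2 : ℕ) : WithBot ℕ∞) ∧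
      AlmostNoDetRepresentation n d ∧
      ∃ p ∈ realZeroSet n d, p ∉ detSet n d) ∧
    (∀ n : ℕ, 3 ≤ n → ∃ d₀ : ℕ, ∀ d : ℕ, d₀ ≤ d →
      semialgebraicDim (realZeroSet n d) = (((n + d).choose d - 1 : ℕ) : WithBot ℕ∞) ∧
      n ^ 3 * d ^ 2 < (n + d).choose d - 1 ∧
      semialgebraicDim (detSet n d) ≤ ((n ^ 3 * d ^ 2 : ℕ) : WithBot ℕ∞) ∧
      AlmostNoDetRepresentation n d ∧
      ∃ p ∈ realZeroSet n d, p ∉ detSet n d) := by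
  refine ⟨fun d hd => ⟨24 * d ^ 2, fun n hn => ?_⟩, fun n hn => ⟨6 * n ^ 3, fun d hd => ?_⟩⟩
  · have h := pow_lt_choose_of_le_left hd hn
    have h' := almostNoDetRepresentation_of_lt h
    exact ⟨semialgebraicDim_realZeroSet n d, h, semialgebraicDim_detSet_le n d, h',
      h'.exists_notMem⟩
  · have h := pow_lt_choose_of_le_right hn hd
    have h' := almostNoDetRepresentation_of_lt h
    exact ⟨semialgebraicDim_realZeroSet n d, h, semialgebraicDim_detSet_le n d, h',
      h'.exists_notMem⟩
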